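/- Let $\mathbb{D}=\{z\in\mathbb{C}:|z|<1\}$, $d\iota(z)=\frac{dz}{\pi(1-|z|^2)^2}$ with $dz$ Lebesgue measure, and for an integer $\nu\ge 2$ let $d\iota_\nu(z)=(\nu-1)(1-|z|^2)^{\nu}\,d\iota(z)$. Let $\mathcal{H}_\nu$ be the Hilbert space of holomorphic functions on $\mathbb{D}$ that are square integrable for $d\iota_\nu$, with the inner product $\langle u,v\rangle_\nu=\int_{\mathbb{D}}u\,\overline{v}\,d\iota_\nu$, and let $K^\nu(x,y)=(1-x\overline{y})^{-\nu}$ and $K^\nu_y=K^\nu(\cdot,y)\in\mathcal{H}_\nu$. A bounded operator $A$ on $\mathcal{H}_\nu$ has the kernel $A(x,y)=(AK^\nu_y)(x)=\langle AK_y^\nu,K_x^\nu\rangle_\nu$ and the covariant symbol $R_\nu(A)(z)=A(z,z)(1-|z|^2)^\nu$. For $f\in L^1(\mathbb{D},d\iota)$ let $R_\nu^*(f)$ be the bounded operator on $\mathcal{H}_\nu$ with kernel $$R_\nu^*(f)(x,y)=\int_{\mathbb{D}}\frac{K^\nu(x,z)f(z)K^\nu(z,y)}{K^\nu(z,z)}\,d\iota(z)$$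 (that is, $\frac1{\nu-1}$ times the Toeplitz operator with symbol $f$), let $B_\nu(f)=R_\nu(R_\nu^*(f))$ be the Berezin transform, and for integers $\mu\ge2$, $k\ge0$ let $$E_{\mu,k}(f)=\frac{(\mu)_k}{k!}\sum_{j=0}^k(-1)^j\binom{k}{j}B_{\mu+j}(f),\qquad (\mu)_k=\mu(\mu+1)\cdots(\mu+k-1).$$ Let $g=\begin{pmatrix}a&b\\ \overline{b}&\overline{a}\end{pmatrix}\in SU(1,1)$ act on functions by $(g\cdot\varphi)(z)=(-bz+\overline{a})^{-\mu}\varphi\big(\tfrac{az-\overline{b}}{-bz+\overline{a}}\big)$ and on $\mathbb{D}$ by $g\cdot z=\frac{\overline{a}z+\overline{b}}{bz+a}$. For a bounded operator $A$ on $\mathcal{H}_\mu$ the generalized Husimi function $H_\mu^k(A):\mathbb{D}\to\mathbb{C}$ is given by $$H_\mu^k(A)(g\cdot 0)=\frac{(\mu)_k}{k!}\,\langle A\,(g\cdot z^k),\,g\cdot z^k\rangle_\mu\qquad(g\in SU(1,1)),$$ which does not depend on the choice of $g$ with a given $g\cdot0$. **Proposition.** Let $\mu\ge2$ and $k\ge0$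 be integers and $f\in L^1(\mathbb{D},d\iota)$. For every integer $\nu\ge2$ there is exactly one bounded operator on $\mathcal{H}_\nu$ with the kernel $R_\nu^*(f)(x,y)$ above, so that the objects above are well defined, and $$E_{\mu,k}(f)(z)=H_\mu^k(R_\mu^*(f))(z)\qquad\text{for all } z\in\mathbb{D}.$$ -/

import Mathlib

open MeasureTheory Complex Metric
open scoped ComplexConjugate Complex.UnitDisc MatrixGroups

noncomputable section

namespace BergmanHusimi

/-! ### The measures on the disc -/

/-- The invariant measure `dι(z) = dz / (π (1 - |z|²)²)` on the open unit disc, as a measure on `ℂ`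
carried by the disc (`dz` is Lebesgue measure on the plane). -/
def iota : Measure ℂ :=
  (volume.restrict (ball (0 : ℂ) 1)).withDensity
    (fun z => ENNReal.ofReal (1 / (Real.pi * (1 - ‖z‖ ^ 2) ^ 2)))

/-- The weighted measure `dι_ν(z) = (ν - 1) (1 - |z|²)^ν dz / (π (1 - |z|²)²)` on the disc
(used for `ν ≥ 2`, where it is a probability measure). -/
def iotaW (ν : ℕ) : Measure ℂ :=
  (volume.restrict (ball (0 : ℂ) 1)).withDensity
    (fun z => ENNReal.ofReal
      ((1 - ‖z‖ ^ 2) ^ ν * (((ν : ℝ) - 1) / (Real.pi * (1 - ‖z‖ ^ 2) ^ 2))))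

instance iotaW_finite (ν : ℕ) : IsFiniteMeasure (iotaW ν) := by
  refine isFiniteMeasure_withDensity (ne_of_lt ?_)
  have hvol : volume (ball (0 : ℂ) 1) < ⊤ := measure_ball_lt_top
  calc ∫⁻ z, ENNReal.ofReal ((1 - ‖z‖ ^ 2) ^ ν * (((ν : ℝ) - 1) / (Real.pi * (1 - ‖z‖ ^ 2) ^ 2)))
          ∂(volume.restrict (ball (0 : ℂ) 1))
      ≤ ∫⁻ _ in ball (0 : ℂ) 1, ENNReal.ofReal (|(ν : ℝ) - 1| / Real.pi) := by
        refine setLIntegral_mono measurable_const fun z hz => ENNReal.ofReal_le_ofReal ?_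
        have hz1 : ‖z‖ < 1 := mem_ball_zero_iff.1 hz
        have h0 : 0 < 1 - ‖z‖ ^ 2 := by nlinarith [norm_nonneg z]
        have h1 : 1 - ‖z‖ ^ 2 ≤ 1 := by nlinarith [norm_nonneg z]
        rcases Nat.lt_or_ge ν 2 with hν | hν
        · have hneg : ((ν : ℝ) - 1) ≤ 0 := by
            have : (ν : ℝ) ≤ 1 := by exact_mod_cast Nat.lt_succ_iff.1 hν
            linarith
          refine le_trans (mul_nonpos_of_nonneg_of_nonpos (by positivity)
            (div_nonpos_of_nonpos_of_nonneg hneg (by positivity))) (by positivity)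
        · obtain ⟨m, rfl⟩ := Nat.exists_eq_add_of_le hν
          have e : (1 - ‖z‖ ^ 2) ^ (2 + m) *
              ((((2 + m : ℕ) : ℝ) - 1) / (Real.pi * (1 - ‖z‖ ^ 2) ^ 2))
              = (1 - ‖z‖ ^ 2) ^ m * ((((2 + m : ℕ) : ℝ) - 1) / Real.pi) := by
            have := Real.pi_pos
            field_simp
            ring
          rw [e]
          have hp : (1 - ‖z‖ ^ 2) ^ m ≤ 1 := pow_le_one₀ h0.le h1
          calc (1 - ‖z‖ ^ 2) ^ m * ((((2 + m : ℕ) : ℝ) - 1) / Real.pi)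
              ≤ (1 - ‖z‖ ^ 2) ^ m * (|((2 + m : ℕ) : ℝ) - 1| / Real.pi) := by
                gcongr
                exact le_abs_self _
            _ ≤ 1 * (|((2 + m : ℕ) : ℝ) - 1| / Real.pi) := by gcongr
            _ = _ := one_mul _
    _ < ⊤ := by
        rw [setLIntegral_const]
        exact ENNReal.mul_lt_top ENNReal.ofReal_lt_top hvol

/-! ### The weighted Bergman spaces -/

/-- The Hilbert space `H_ν` of holomorphic functions on the disc that are square integrable
for `dι_ν`, realised as the subspace of `L²(dι_ν)` of classes that have a representative which is
holomorphic on the disc; norm and inner product are those of `L²(dι_ν)`. -/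
def bergman (ν : ℕ) : Submodule ℂ (Lp ℂ 2 (iotaW ν)) where
  carrier := {u | ∃ F : ℂ → ℂ, DifferentiableOn ℂ F (ball 0 1) ∧ u =ᵐ[iotaW ν] F}
  zero_mem' := ⟨fun _ => 0, differentiableOn_const 0, Lp.coeFn_zero _ _ _⟩
  add_mem' := by
    rintro u v ⟨F, hF, hu⟩ ⟨G, hG, hv⟩
    exact ⟨F + G, hF.add hG, (Lp.coeFn_add u v).trans (hu.add hv)⟩
  smul_mem' := by
    rintro c u ⟨F, hF, hu⟩
    exact ⟨c • F, hF.const_smul c, (Lp.coeFn_smul c u).trans (hu.const_smul c)⟩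

theorem memLp_of_holo (ν : ℕ) {F : ℂ → ℂ}
    (hF : ∀ z ∈ closedBall (0 : ℂ) 1, DifferentiableAt ℂ F z) : MemLp F 2 (iotaW ν) := by
  have hc : ContinuousOn F (closedBall (0 : ℂ) 1) := fun z hz =>
    (hF z hz).continuousAt.continuousWithinAt
  obtain ⟨C, hC⟩ := (isCompact_closedBall (0 : ℂ) 1).exists_bound_of_continuousOn hc
  have hac : iotaW ν ≪ volume.restrict (ball (0 : ℂ) 1) := withDensity_absolutelyContinuous _ _
  refine MemLp.of_bound (C := C) ?_ ?_
  · exact ((hc.mono ball_subset_closedBall).aestronglyMeasurable measurableSet_ball).mono_ac hac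
  · refine hac.ae_le ?_
    filter_upwards [ae_restrict_mem measurableSet_ball] with z hz
    exact hC z (ball_subset_closedBall hz)

/-- The element of `H_ν` given by a function that is holomorphic near the closed disc. -/
def ofHolo (ν : ℕ) (F : ℂ → ℂ)
    (hF : ∀ z ∈ closedBall (0 : ℂ) 1, DifferentiableAt ℂ F z) : bergman ν :=
  ⟨(memLp_of_holo ν hF).toLp F, F,
    fun z hz => (hF z (ball_subset_closedBall hz)).differentiableWithinAt, MemLp.coeFn_toLp _⟩

/-- The reproducing kernel `K^ν(x, y) = (1 - x ȳ)^{-ν}`. -/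
def K (ν : ℕ) (x y : ℂ) : ℂ := ((1 - x * conj y) ^ ν)⁻¹

theorem one_sub_mul_conj_ne_zero {x y : ℂ} (hx : ‖x‖ ≤ 1) (hy : ‖y‖ < 1) :
    1 - x * conj y ≠ 0 := by
  intro h
  have h1 : ‖x * conj y‖ = 1 := by rw [← sub_eq_zero.1 h, norm_one]
  rw [norm_mul, RCLike.norm_conj] at h1
  nlinarith [norm_nonneg x, norm_nonneg y]

theorem K_differentiableAt (ν : ℕ) (y : 𝔻) :
    ∀ x ∈ closedBall (0 : ℂ) 1, DifferentiableAt ℂ (fun x => K ν x y) x := by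
  intro x hx
  have hne := one_sub_mul_conj_ne_zero (mem_closedBall_zero_iff.1 hx) y.norm_lt_one
  unfold K
  exact DifferentiableAt.fun_inv (by fun_prop) (pow_ne_zero _ hne)

/-- The kernel vector `K_y^ν = K^ν(·, y) ∈ H_ν`. -/
def kvec (ν : ℕ) (y : 𝔻) : bergman ν := ofHolo ν (fun x => K ν x y) (K_differentiableAt ν y)

/-! ### Covariant symbol, Toeplitz operator and Berezin transform

Mathlib's `inner ℂ u v` is linear in `v`; the pairing `⟨u, v⟩` linear in `u` is `inner ℂ v u`. -/

/-- The integral kernel `A(x, y) = (A K_y)(x) = ⟨A K_y, K_x⟩` of a bounded operator `A` on `H_ν`. -/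
def opKernel (ν : ℕ) (A : bergman ν →L[ℂ] bergman ν) (x y : 𝔻) : ℂ :=
  inner ℂ (kvec ν x) (A (kvec ν y))

/-- The covariant symbol `R_ν(A)(z) = A(z, z) (1 - |z|²)^ν`. -/
def covSymbol (ν : ℕ) (A : bergman ν →L[ℂ] bergman ν) (z : 𝔻) : ℂ :=
  opKernel ν A z z * (1 - (‖(z : ℂ)‖ : ℂ) ^ 2) ^ ν

/-- The kernel `∫ K^ν(x,z) f(z) K^ν(z,y) / K^ν(z,z) dι(z)`. -/
def toeplitzKernel (ν : ℕ) (f : ℂ → ℂ) (x y : 𝔻) : ℂ :=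
  ∫ z, K ν x z * f z * K ν z y / K ν z z ∂iota

/-- `T` is the operator `R_ν^*(f) = (ν - 1)⁻¹ T_f`: the bounded operator on `H_ν`
with kernel `toeplitzKernel ν f`. -/
def IsToeplitz (ν : ℕ) (f : ℂ → ℂ) (T : bergman ν →L[ℂ] bergman ν) : Prop :=
  ∀ x y : 𝔻, opKernel ν T x y = toeplitzKernel ν f x y

open Classical in
/-- The operator `R_ν^*(f)`. (The value `0` is a placeholder for the case that no bounded operator
has the required kernel; for `f ∈ L¹(dι)` and `ν ≥ 2` there is exactly one.) -/
def toeplitz (ν : ℕ) (f : ℂ → ℂ) : bergman ν →L[ℂ] bergman ν :=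
  if h : ∃ T, IsToeplitz ν f T then h.choose else 0

/-- The Berezin transform `B_ν = R_ν R_ν^*`. -/
def berezin (ν : ℕ) (f : ℂ → ℂ) : 𝔻 → ℂ := covSymbol ν (toeplitz ν f)

/-- `E_{μ,k}(f) = (μ)_k / k! ∑_{j=0}^k (-1)^j (k choose j) B_{μ+j}(f)`, where
`(μ)_k = μ (μ+1) ⋯ (μ+k-1)`. -/
def E (μ k : ℕ) (f : ℂ → ℂ) (z : 𝔻) : ℂ :=
  (ascPochhammer ℂ k).eval (μ : ℂ) / (k.factorial : ℂ) *
    ∑ j ∈ Finset.range (k + 1), (-1) ^ j * (k.choose j : ℂ) * berezin (μ + j) f z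

/-! ### The group `SU(1,1)`, its action on the disc and on functions -/

/-- `SU(1,1)`: the matrices `!![a, b; b̄, ā]` of determinant `|a|² - |b|² = 1`, as a subgroup
of `SL(2, ℂ)`. -/
def su11 : Subgroup SL(2, ℂ) where
  carrier := {g | g.1 1 0 = conj (g.1 0 1) ∧ g.1 1 1 = conj (g.1 0 0)}
  one_mem' := by simp
  mul_mem' := by
    rintro g h ⟨hg1, hg2⟩ ⟨hh1, hh2⟩
    simp only [Set.mem_ofPred_eq, Matrix.SpecialLinearGroup.coe_mul, Matrix.mul_apply,
      Fin.sum_univ_two, map_add, map_mul, hg1, hg2, hh1, hh2, conj_conj]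
    constructor <;> ring
  inv_mem' := by
    rintro g ⟨hg1, hg2⟩
    simp [Matrix.SpecialLinearGroup.coe_inv, Matrix.adjugate_fin_two, hg1, hg2]

/-- The group `SU(1,1)`. -/
abbrev SU11 : Type := su11

namespace SU11

/-- The entry `a` of `!![a, b; b̄, ā]`. -/
def a (g : SU11) : ℂ := g.1.1 0 0

/-- The entry `b` of `!![a, b; b̄, ā]`. -/
def b (g : SU11) : ℂ := g.1.1 0 1

theorem rel (g : SU11) : g.a * conj g.a - g.b * conj g.b = 1 := by
  have h := g.1.2
  rw [Matrix.det_fin_two, g.2.1, g.2.2] at h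
  exact h

theorem rel_norm (g : SU11) : ‖g.a‖ ^ 2 - ‖g.b‖ ^ 2 = 1 := by
  have h := g.rel
  rw [mul_conj', mul_conj'] at h
  exact_mod_cast h

theorem norm_b_lt (g : SU11) : ‖g.b‖ < ‖g.a‖ := by
  have := g.rel_norm
  nlinarith [norm_nonneg g.a, norm_nonneg g.b]

/-- The matrix `!![a, b; b̄, ā]` as an element of `SU(1,1)`. -/
def mk (a b : ℂ) (h : a * conj a - b * conj b = 1) : SU11 :=
  ⟨⟨!![a, b; conj b, conj a], by rw [Matrix.det_fin_two_of]; exact h⟩, rfl, rfl⟩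

theorem den_ne_zero (g : SU11) {z : ℂ} (hz : ‖z‖ ≤ 1) : -g.b * z + conj g.a ≠ 0 := by
  intro h
  have h1 : conj g.a = g.b * z := by linear_combination h
  have h2 := congrArg norm h1
  rw [RCLike.norm_conj, norm_mul] at h2
  nlinarith [g.norm_b_lt, norm_nonneg g.b, norm_nonneg z]

theorem den_ne_zero' (g : SU11) {z : ℂ} (hz : ‖z‖ ≤ 1) : g.b * z + g.a ≠ 0 := by
  intro h
  have h1 : g.a = -(g.b * z) := by linear_combination h
  have h2 := congrArg norm h1
  rw [norm_neg, norm_mul] at h2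
  nlinarith [g.norm_b_lt, norm_nonneg g.b, norm_nonneg z]

theorem norm_moebius_lt (g : SU11) (z : 𝔻) :
    ‖(conj g.a * (z : ℂ) + conj g.b) / (g.b * z + g.a)‖ < 1 := by
  have hd := g.den_ne_zero' z.norm_lt_one.le
  rw [norm_div, div_lt_one (norm_pos_iff.2 hd)]
  refine lt_of_pow_lt_pow_left₀ 2 (norm_nonneg _) ?_
  have key : ‖g.b * (z : ℂ) + g.a‖ ^ 2 - ‖conj g.a * (z : ℂ) + conj g.b‖ ^ 2 = 1 - ‖(z : ℂ)‖ ^ 2 := by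
    have hr := g.rel
    have : ((‖g.b * (z : ℂ) + g.a‖ ^ 2 - ‖conj g.a * (z : ℂ) + conj g.b‖ ^ 2 : ℝ) : ℂ)
        = ((1 - ‖(z : ℂ)‖ ^ 2 : ℝ) : ℂ) := by
      push_cast
      rw [← mul_conj', ← mul_conj', ← mul_conj']
      simp only [map_add, map_mul, conj_conj]
      linear_combination (1 - (z : ℂ) * conj (z : ℂ)) * hr
    exact_mod_cast this
  have := z.sq_norm_lt_one
  linarith

/-- The left action of `SU(1,1)` on the disc, `g • z = (ā z + b̄) / (b z + a)`; it is the one for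
which `(g • φ)(z)` below is a multiple of `φ (g⁻¹ • z)`. -/
instance : MulAction SU11 𝔻 where
  smul g z := UnitDisc.mk ((conj g.a * z + conj g.b) / (g.b * z + g.a)) (g.norm_moebius_lt z)
  one_smul z := by
    apply UnitDisc.coe_injective
    change (conj (a 1) * (z : ℂ) + conj (b 1)) / (b 1 * z + a 1) = z
    simp [a, b]
  mul_smul g h z := by
    apply UnitDisc.coe_injective
    change (conj (a (g * h)) * (z : ℂ) + conj (b (g * h))) / (b (g * h) * z + a (g * h)) =
      (conj g.a * ((conj h.a * z + conj h.b) / (h.b * z + h.a)) + conj g.b) /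
        (g.b * ((conj h.a * z + conj h.b) / (h.b * z + h.a)) + g.a)
    have ha : a (g * h) = g.a * h.a + g.b * conj h.b := by
      simp only [a, b, Subgroup.coe_mul, Matrix.SpecialLinearGroup.coe_mul, Matrix.mul_apply,
        Fin.sum_univ_two, h.2.1]
    have hb : b (g * h) = g.a * h.b + g.b * conj h.a := by
      simp only [a, b, Subgroup.coe_mul, Matrix.SpecialLinearGroup.coe_mul, Matrix.mul_apply,
        Fin.sum_univ_two, h.2.2]
    have hd := h.den_ne_zero' z.norm_lt_one.le
    rw [← mul_div_mul_right (conj g.a * ((conj h.a * z + conj h.b) / (h.b * z + h.a)) + conj g.b)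
      _ hd, ha, hb]
    simp only [map_add, map_mul, conj_conj, add_mul, mul_assoc, div_mul_cancel₀ _ hd]
    congr 1 <;> ring

theorem coe_smul (g : SU11) (z : 𝔻) :
    ((g • z : 𝔻) : ℂ) = (conj g.a * z + conj g.b) / (g.b * z + g.a) := rfl

end SU11

/-- The action of `SU(1,1)` of weight `ν` on functions,
`(g • φ)(z) = (-b z + ā)^{-ν} φ((a z - b̄) / (-b z + ā))`. -/
def act (ν : ℕ) (g : SU11) (φ : ℂ → ℂ) (z : ℂ) : ℂ :=
  ((-g.b * z + conj g.a) ^ ν)⁻¹ * φ ((g.a * z - conj g.b) / (-g.b * z + conj g.a))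

theorem act_eq (ν : ℕ) (g : SU11) (φ : ℂ → ℂ) (z : 𝔻) :
    act ν g φ z = ((-g.b * z + conj g.a) ^ ν)⁻¹ * φ ((g⁻¹ • z : 𝔻) : ℂ) := by
  have ha : (g⁻¹).a = conj g.a := by
    simp [SU11.a, Matrix.SpecialLinearGroup.coe_inv, Matrix.adjugate_fin_two, g.2.2]
  have hb : (g⁻¹).b = -g.b := by
    simp [SU11.b, Matrix.SpecialLinearGroup.coe_inv, Matrix.adjugate_fin_two]
  rw [act, SU11.coe_smul, ha, hb]
  simp [sub_eq_add_neg]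

theorem act_monomial_differentiableAt (ν : ℕ) (g : SU11) (i : ℕ) :
    ∀ z ∈ closedBall (0 : ℂ) 1, DifferentiableAt ℂ (act ν g (fun w => w ^ i)) z := by
  intro z hz
  have hne := g.den_ne_zero (mem_closedBall_zero_iff.1 hz)
  unfold act
  have hden : DifferentiableAt ℂ (fun z : ℂ => -g.b * z + conj g.a) z :=
    (differentiableAt_id.const_mul (-g.b)).add_const (conj g.a)
  have hnum : DifferentiableAt ℂ (fun z : ℂ => g.a * z - conj g.b) z :=
    (differentiableAt_id.const_mul g.a).sub_const (conj g.b)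
  exact ((hden.fun_pow ν).fun_inv (pow_ne_zero _ hne)).fun_mul ((hnum.fun_div hden hne).fun_pow i)

/-- The vector `g • z^i ∈ H_ν`. -/
def actMonomial (ν : ℕ) (g : SU11) (i : ℕ) : bergman ν :=
  ofHolo ν (act ν g (fun w => w ^ i)) (act_monomial_differentiableAt ν g i)

/-! ### Generalized Husimi functions -/

theorem exists_smul_zero (z : 𝔻) : ∃ g : SU11, g • (0 : 𝔻) = z := by
  have h0 : 0 < 1 - ‖(z : ℂ)‖ ^ 2 := by linarith [z.sq_norm_lt_one]
  set s : ℝ := (Real.sqrt (1 - ‖(z : ℂ)‖ ^ 2))⁻¹ with hs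
  have hs0 : s ≠ 0 := inv_ne_zero (Real.sqrt_pos.2 h0).ne'
  have hs2 : s ^ 2 * (1 - ‖(z : ℂ)‖ ^ 2) = 1 := by
    rw [hs, inv_pow, Real.sq_sqrt h0.le, inv_mul_cancel₀ h0.ne']
  have hrel : (s : ℂ) * conj (s : ℂ) - (s * conj (z : ℂ)) * conj (s * conj (z : ℂ)) = 1 := by
    have : ((s ^ 2 * (1 - ‖(z : ℂ)‖ ^ 2) : ℝ) : ℂ) = 1 := by rw [hs2]; simp
    push_cast at this
    rw [← mul_conj'] at this
    simp only [map_mul, conj_conj, conj_ofReal]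
    linear_combination this
  refine ⟨SU11.mk s (s * conj (z : ℂ)) hrel, ?_⟩
  apply UnitDisc.coe_injective
  rw [SU11.coe_smul]
  have hs0' : (s : ℂ) ≠ 0 := by exact_mod_cast hs0
  simp [SU11.mk, SU11.a, SU11.b, hs0']

/-- The generalized Husimi function `H_ν^i(A)`, defined by
`H_ν^i(A)(g • 0) = (ν)_i / i! ⟨A (g • z^i), g • z^i⟩_ν`. The value does not depend on the choice
of `g`, see `husimi_smul_zero`. -/
def husimi (ν i : ℕ) (A : bergman ν →L[ℂ] bergman ν) (z : 𝔻) : ℂ :=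
  (ascPochhammer ℂ i).eval (ν : ℂ) / (i.factorial : ℂ) *
    inner ℂ (actMonomial ν (exists_smul_zero z).choose i)
      (A (actMonomial ν (exists_smul_zero z).choose i))

/-- Two elements of `SU(1,1)` that move `0` to the same point differ by a unimodular factor. -/
theorem exists_phase {g h : SU11} (hgh : g • (0 : 𝔻) = h • (0 : 𝔻)) :
    ∃ c : ℂ, c * conj c = 1 ∧ g.a = c * h.a ∧ g.b = conj c * h.b := by
  have h1 := congrArg UnitDisc.coe hgh
  simp only [SU11.coe_smul, UnitDisc.coe_zero, mul_zero, zero_add] at h1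
  have hga : g.a ≠ 0 := norm_pos_iff.1 (lt_of_le_of_lt (norm_nonneg _) g.norm_b_lt)
  have hha : h.a ≠ 0 := norm_pos_iff.1 (lt_of_le_of_lt (norm_nonneg _) h.norm_b_lt)
  rw [div_eq_div_iff hga hha] at h1
  have h2 := congrArg conj h1
  simp only [map_mul, conj_conj] at h2
  have hcg : conj g.a ≠ 0 := by simpa using hga
  have hch : conj h.a ≠ 0 := by simpa using hha
  have hb : g.b = conj (g.a / h.a) * h.b := by
    rw [map_div₀, div_mul_eq_mul_div, eq_div_iff hch]
    linear_combination h2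
  have ha : g.a = g.a / h.a * h.a := by field_simp
  refine ⟨g.a / h.a, ?_, ha, hb⟩
  have hg := g.rel
  have hh := h.rel
  generalize g.a / h.a = c at ha hb
  rw [ha, hb] at hg
  simp only [map_mul, conj_conj] at hg
  linear_combination hg - (c * conj c) * hh

theorem actMonomial_phase (ν i : ℕ) {g h : SU11} {c : ℂ} (hc : c * conj c = 1)
    (ha : g.a = c * h.a) (hb : g.b = conj c * h.b) :
    actMonomial ν g i = (c ^ ν * (c ^ 2) ^ i) • actMonomial ν h i := by
  have hc0 : c ≠ 0 := left_ne_zero_of_mul_eq_one hc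
  have hcc : conj c = c⁻¹ := eq_inv_of_mul_eq_one_right hc
  apply Subtype.ext
  apply Lp.ext
  rw [Submodule.coe_smul]
  refine (MemLp.coeFn_toLp (memLp_of_holo ν (act_monomial_differentiableAt ν g i))).trans ?_
  refine Filter.EventuallyEq.trans ?_ (Lp.coeFn_smul _ _).symm
  refine Filter.EventuallyEq.trans (Filter.Eventually.of_forall fun z => ?_)
    ((MemLp.coeFn_toLp (memLp_of_holo ν (act_monomial_differentiableAt ν h i))).const_smul _).symm
  have e1 : -g.b * z + conj g.a = c⁻¹ * (-h.b * z + conj h.a) := by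
    rw [ha, hb, map_mul, hcc]; ring
  have e2 : g.a * z - conj g.b = c * (h.a * z - conj h.b) := by
    rw [ha, hb, map_mul, conj_conj]; ring
  have e3 : (g.a * z - conj g.b) / (-g.b * z + conj g.a)
      = c ^ 2 * ((h.a * z - conj h.b) / (-h.b * z + conj h.a)) := by
    rw [e1, e2, mul_div_mul_comm, div_inv_eq_mul]; ring
  simp only [act, Pi.smul_apply, smul_eq_mul]
  rw [e3, e1, mul_pow, mul_pow, mul_inv, inv_pow, inv_inv]
  ring

/-- `H_ν^i(A)` is well defined: its defining formula holds for every `g ∈ SU(1,1)`. -/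
theorem husimi_smul_zero (ν i : ℕ) (A : bergman ν →L[ℂ] bergman ν) (g : SU11) :
    husimi ν i A (g • (0 : 𝔻)) = (ascPochhammer ℂ i).eval (ν : ℂ) / (i.factorial : ℂ) *
      inner ℂ (actMonomial ν g i) (A (actMonomial ν g i)) := by
  obtain ⟨c, hc, ha, hb⟩ := exists_phase (exists_smul_zero (g • (0 : 𝔻))).choose_spec
  rw [husimi, actMonomial_phase ν i hc ha hb, map_smul,
    inner_smul_left (𝕜 := ℂ) (E := bergman ν), inner_smul_right (𝕜 := ℂ) (E := bergman ν), ← mul_assoc (conj _)]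
  have : conj (c ^ ν * (c ^ 2) ^ i) * (c ^ ν * (c ^ 2) ^ i)
      = (c * conj c) ^ ν * ((c * conj c) ^ 2) ^ i := by
    simp only [map_mul, map_pow, mul_pow]; ring
  rw [this, hc]
  simp

end BergmanHusimi

end

/-!
Both sides of the identity are integrals of `f` against an explicit function, and these functions
agree pointwise. Write `z = g • 0` and
`t = (1 - |z|²)(1 - |w|²) / |1 - w z̄|² = 1 - |g⁻¹ • w|²` (`berezinFactor`).

* The operator `R_ν^*(f)` is the operator of the sesquilinear form
  `(u, v) ↦ ∫ ū v (1 - |w|²)^ν f dι` (`inner_toeplitz_ofHolo`). Evaluated at kernel vectors, this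
  gives `B_ν(f)(z) = ∫ t^ν f dι`, so by the binomial theorem the alternating sum in `E_{μ,k}(f)(z)`
  is `∫ t^μ (1 - t)^k f dι` (`E_eq_integral`).
* Evaluated at `g • w^k`, the form gives `∫ |(g • w^k)(w)|² (1 - |w|²)^μ f dι`, and
  `|(g • w^k)(w)|² (1 - |w|²)^μ = (1 - |g⁻¹ • w|²)^μ |g⁻¹ • w|^{2k} = t^μ (1 - t)^k`
  (`husimi_toeplitz_eq_integral`).

That `R_ν^*(f)` exists and is unique rests on the reproducing property `⟨F, K_y⟩ = F(y)`
(`inner_kvec`). For `y = g • 0` the change of variables `x = g • u` turns `⟨F, K_y⟩` into the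
integral of a holomorphic function of `u` against a radial probability density, so the mean value
property on circles gives its value at `u = 0` (`setIntegral_weight_smul`). Consequently
`|F(z)|² (1 - |z|²)^ν ≤ ‖F‖²`. By this bound the form above is bounded by `‖f‖₁`, and `L²`-limits of
holomorphic functions are locally uniform limits, so `H_ν` is complete and the form is given by an
operator. Uniqueness holds because a vector orthogonal to all `K_y` vanishes.
-/

noncomputable section

namespace BergmanHusimi

/-! ### Mean values over the disc for radial weights -/

/-- Averaging an integrable function over rotations about `0` does not change its integral. -/
theorem integral_circleAverage_mul {H : ℂ → ℂ} (hH : Integrable H) :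
    ∫ z, Real.circleAverage (fun w => H (w * z)) 0 1 = ∫ z, H z := by
  have hrot : ∀ θ : ℝ, MeasurePreserving (fun z : ℂ => circleMap 0 1 θ * z) := fun θ => by
    have := (rotation ⟨circleMap 0 1 θ, by simp [Submonoid.unitSphere]⟩).measurePreserving
    exact this
  set ν : Measure ℝ := volume.restrict (Set.Ioc 0 (2 * Real.pi)) with hν
  -- The shear `(θ, z) ↦ (θ, e^{iθ} z)` preserves the product measure, which provides the joint
  -- integrability needed for Fubini.
  have hskew : MeasurePreserving (fun p : ℝ × ℂ => (p.1, circleMap 0 1 p.1 * p.2))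
      (ν.prod volume) (ν.prod volume) :=
    (MeasurePreserving.id ν).skew_product (g := fun θ z => circleMap 0 1 θ * z)
      (by fun_prop) (Filter.Eventually.of_forall fun θ => (hrot θ).map_eq)
  have hint : Integrable (fun p : ℝ × ℂ => H (circleMap 0 1 p.1 * p.2)) (ν.prod volume) :=
    hskew.integrable_comp_of_integrable (g := fun p : ℝ × ℂ => H p.2) (hH.comp_snd ν)
  have hpi : (0 : ℝ) ≤ 2 * Real.pi := by positivity
  simp only [Real.circleAverage_def, intervalIntegral.integral_of_le hpi]
  rw [integral_smul, ← hν, ← integral_integral_swap (f := fun θ z => H (circleMap 0 1 θ * z)) hint]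
  have : ∀ θ : ℝ, ∫ z, H (circleMap 0 1 θ * z) = ∫ z, H z := fun θ => by
    have h0 : circleMap 0 1 θ ≠ 0 := by simp
    exact (hrot θ).integral_comp
      (Homeomorph.mulLeft₀ _ h0).measurableEmbedding H
  simp only [this, integral_const, hν]
  have hpi0 : (Real.pi : ℂ) ≠ 0 := by exact_mod_cast Real.pi_pos.ne'
  simp [measureReal_def, ENNReal.toReal_ofReal Real.pi_pos.le]
  field_simp

theorem setIntegral_one_sub_norm_sq_pow (m : ℕ) :
    ∫ z in ball (0 : ℂ) 1, (1 - ‖z‖ ^ 2) ^ m = Real.pi / (m + 1) := by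
  have h := integral_fun_norm_addHaar (E := ℂ) volume
    (fun r : ℝ => (Set.Iio (1 : ℝ)).indicator (fun r => (1 - r ^ 2) ^ m) r)
  have hvol : (volume : Measure ℂ).real (ball 0 1) = Real.pi := by simp [measureReal_def]
  have e : ∀ z : ℂ, (Set.Iio (1 : ℝ)).indicator (fun r => (1 - r ^ 2) ^ m) ‖z‖
      = (ball (0 : ℂ) 1).indicator (fun z => (1 - ‖z‖ ^ 2) ^ m) z := fun z => by
    by_cases hz : ‖z‖ < 1 <;> simp [hz]
  simp only [e, Complex.finrank_real_complex, hvol, integral_indicator measurableSet_ball] at h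
  rw [h]
  have e2 : ∀ r : ℝ, r ^ (2 - 1) • (Set.Iio (1 : ℝ)).indicator (fun r => (1 - r ^ 2) ^ m) r
      = (Set.Iio (1 : ℝ)).indicator (fun r => r * (1 - r ^ 2) ^ m) r := fun r => by
    by_cases hr : r < 1 <;> simp [hr]
  have hd : ∀ x ∈ Set.uIcc (0 : ℝ) 1, HasDerivAt
      (fun r : ℝ => -(1 - r ^ 2) ^ (m + 1) / (2 * (m + 1))) (x * (1 - x ^ 2) ^ m) x := by
    intro x _
    have h1 : HasDerivAt (fun r : ℝ => 1 - r ^ 2) (-(2 * x)) x := by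
      simpa using (hasDerivAt_pow 2 x).const_sub 1
    refine ((h1.pow (m + 1)).neg.div_const (2 * (m + 1) : ℝ)).congr_deriv ?_
    push_cast
    field_simp
  simp only [e2]
  rw [setIntegral_indicator measurableSet_Iio, Set.Ioi_inter_Iio, ← integral_Ioc_eq_integral_Ioo,
    ← intervalIntegral.integral_of_le zero_le_one,
    intervalIntegral.integral_eq_sub_of_hasDerivAt hd
      (Continuous.intervalIntegrable (by fun_prop) _ _)]
  simp
  field_simp

/-- The mean value property of a holomorphic function, integrated against the radial weight
`(1 - |z|²)^m`. -/
theorem setIntegral_weight_smul {m : ℕ} {G : ℂ → ℂ} (hG : DifferentiableOn ℂ G (ball 0 1))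
    (hint : IntegrableOn (fun z => (1 - ‖z‖ ^ 2) ^ m • G z) (ball (0 : ℂ) 1)) :
    ∫ z in ball (0 : ℂ) 1, (1 - ‖z‖ ^ 2) ^ m • G z = (Real.pi / (m + 1)) • G 0 := by
  rw [← integral_indicator measurableSet_ball, ← integral_circleAverage_mul
    ((integrable_indicator_iff measurableSet_ball).2 hint)]
  -- For `|z| < 1` the function `w ↦ G (w z)` is holomorphic near the closed unit disc, and its mean
  -- over the unit circle is `G 0`.
  have e : ∀ z : ℂ, Real.circleAverage (fun w => (ball (0 : ℂ) 1).indicator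
      (fun z => (1 - ‖z‖ ^ 2) ^ m • G z) (w * z)) 0 1
      = (ball (0 : ℂ) 1).indicator (fun z => (1 - ‖z‖ ^ 2) ^ m • G 0) z := by
    intro z
    by_cases hz : ‖z‖ < 1
    · have h1 : Set.EqOn (fun w => (ball (0 : ℂ) 1).indicator
          (fun z => (1 - ‖z‖ ^ 2) ^ m • G z) (w * z))
          (fun w => (1 - ‖z‖ ^ 2) ^ m • G (w * z)) (sphere 0 |1|) := by
        intro w hw
        have hw1 : ‖w‖ = 1 := by simpa using hw
        simp [hw1, hz]
      have h2 : DiffContOnCl ℂ (fun w => (1 - ‖z‖ ^ 2) ^ m • G (w * z)) (ball 0 |1|) := by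
        apply DifferentiableOn.diffContOnCl
        have hm : DifferentiableOn ℂ (fun w : ℂ => w * z) (closure (ball 0 |1|)) := by fun_prop
        refine DifferentiableOn.fun_const_smul (hG.comp hm ?_) _
        intro w hw
        rw [abs_one, closure_ball _ one_ne_zero, mem_closedBall_zero_iff] at hw
        rw [mem_ball_zero_iff, norm_mul]
        nlinarith [norm_nonneg w, norm_nonneg z]
      rw [Real.circleAverage_congr_sphere h1, h2.circleAverage]
      simp [hz]
    · have h1 : Set.EqOn (fun w => (ball (0 : ℂ) 1).indicator
          (fun z => (1 - ‖z‖ ^ 2) ^ m • G z) (w * z)) (fun _ => 0) (sphere 0 |1|) := by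
        intro w hw
        have hw1 : ‖w‖ = 1 := by simpa using hw
        simp [hw1, hz]
      rw [Real.circleAverage_congr_sphere h1, Real.circleAverage_const]
      simp [hz]
  simp only [e]
  rw [integral_indicator measurableSet_ball, integral_smul_const, setIntegral_one_sub_norm_sq_pow]

/-! ### Möbius transformations of the disc -/

namespace SU11

theorem image_moebius_ball (g : SU11) :
    (fun u : ℂ => (conj g.a * u + conj g.b) / (g.b * u + g.a)) '' ball 0 1 = ball 0 1 := by
  have h : (fun u : ℂ => (conj g.a * u + conj g.b) / (g.b * u + g.a)) '' ball 0 1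
      ⊆ ball 0 1 := by
    rintro _ ⟨u, hu, rfl⟩
    exact mem_ball_zero_iff.2 (g.norm_moebius_lt (UnitDisc.mk u (mem_ball_zero_iff.1 hu)))
  refine h.antisymm fun x hx => ?_
  have hx1 := mem_ball_zero_iff.1 hx
  refine ⟨((g⁻¹ • UnitDisc.mk x hx1 : 𝔻) : ℂ), mem_ball_zero_iff.2 (UnitDisc.norm_lt_one _), ?_⟩
  change (((g • (g⁻¹ • UnitDisc.mk x hx1) : 𝔻)) : ℂ) = x
  rw [smul_inv_smul, UnitDisc.coe_mk]

theorem injOn_moebius (g : SU11) :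
    Set.InjOn (fun u : ℂ => (conj g.a * u + conj g.b) / (g.b * u + g.a)) (ball 0 1) := by
  intro u hu v hv h
  have hu1 := mem_ball_zero_iff.1 hu
  have hv1 := mem_ball_zero_iff.1 hv
  have h1 : g • UnitDisc.mk u hu1 = g • UnitDisc.mk v hv1 := UnitDisc.coe_injective h
  simpa using congrArg (fun z : 𝔻 => (z : ℂ)) (smul_left_cancel g h1)

theorem hasDerivAt_moebius (g : SU11) {u : ℂ} (hu : ‖u‖ ≤ 1) :
    HasDerivAt (fun u : ℂ => (conj g.a * u + conj g.b) / (g.b * u + g.a))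
      (((g.b * u + g.a) ^ 2)⁻¹) u := by
  have hd := g.den_ne_zero' hu
  have h1 : HasDerivAt (fun u : ℂ => conj g.a * u + conj g.b) (conj g.a) u := by
    simpa using ((hasDerivAt_id u).const_mul (conj g.a)).add_const (conj g.b)
  have h2 : HasDerivAt (fun u : ℂ => g.b * u + g.a) g.b u := by
    simpa using ((hasDerivAt_id u).const_mul g.b).add_const g.a
  refine (h1.div h2 hd).congr_deriv ?_
  rw [inv_eq_one_div]
  congr 1
  linear_combination g.rel

end SU11

/-- The real Jacobian determinant of multiplication by the complex number `c` is `|c|²`. -/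
theorem abs_det_restrictScalars_toSpanSingleton (c : ℂ) :
    |((ContinuousLinearMap.toSpanSingleton ℂ c).restrictScalars ℝ).det| = ‖c‖ ^ 2 := by
  have : (((ContinuousLinearMap.toSpanSingleton ℂ c).restrictScalars ℝ : ℂ →L[ℝ] ℂ) : ℂ →ₗ[ℝ] ℂ)
      = (ContinuousLinearMap.toSpanSingleton ℂ c : ℂ →ₗ[ℂ] ℂ).restrictScalars ℝ := rfl
  rw [ContinuousLinearMap.det, this, LinearMap.det_restrictScalars]
  simp [Algebra.norm_complex_apply, Complex.normSq_eq_norm_sq, abs_of_nonneg]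

/-! ### The weighted measures as densities on the disc -/

theorem one_sub_norm_sq_pos {z : ℂ} (hz : z ∈ ball (0 : ℂ) 1) : 0 < 1 - ‖z‖ ^ 2 := by
  have := mem_ball_zero_iff.1 hz
  nlinarith [norm_nonneg z]

theorem weight_eq {ν : ℕ} (hν : 2 ≤ ν) {z : ℂ} (hz : z ∈ ball (0 : ℂ) 1) :
    (1 - ‖z‖ ^ 2) ^ ν * (((ν : ℝ) - 1) / (Real.pi * (1 - ‖z‖ ^ 2) ^ 2))
      = ((ν : ℝ) - 1) / Real.pi * (1 - ‖z‖ ^ 2) ^ (ν - 2) := by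
  have h0 := one_sub_norm_sq_pos hz
  obtain ⟨m, rfl⟩ := Nat.exists_eq_add_of_le hν
  rw [Nat.add_sub_cancel_left, pow_add]
  field_simp

theorem weight_pos {ν : ℕ} (hν : 2 ≤ ν) {z : ℂ} (hz : z ∈ ball (0 : ℂ) 1) :
    0 < ((ν : ℝ) - 1) / Real.pi * (1 - ‖z‖ ^ 2) ^ (ν - 2) := by
  have h0 := one_sub_norm_sq_pos hz
  have h2 : (2 : ℝ) ≤ ν := by exact_mod_cast hν
  have h1 : 0 < (ν : ℝ) - 1 := by linarith
  positivity

/-- The density of `dι_ν` is `(ν - 1) / π` times `(1 - |z|²)^(ν - 2)` on the disc. -/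
theorem toReal_weight_ae {ν : ℕ} (hν : 2 ≤ ν) (h : ℂ → ℂ) :
    (fun z => (ENNReal.ofReal
      ((1 - ‖z‖ ^ 2) ^ ν * (((ν : ℝ) - 1) / (Real.pi * (1 - ‖z‖ ^ 2) ^ 2)))).toReal • h z)
      =ᵐ[volume.restrict (ball (0 : ℂ) 1)]
      fun z => (((ν : ℝ) - 1) / Real.pi) • ((1 - ‖z‖ ^ 2) ^ (ν - 2) • h z) := by
  filter_upwards [ae_restrict_mem measurableSet_ball] with z hz
  rw [weight_eq hν hz, ENNReal.toReal_ofReal (weight_pos hν hz).le, mul_smul]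

theorem integral_iotaW {ν : ℕ} (hν : 2 ≤ ν) (h : ℂ → ℂ) :
    ∫ z, h z ∂iotaW ν = (((ν : ℝ) - 1) / Real.pi) •
      ∫ z in ball (0 : ℂ) 1, (1 - ‖z‖ ^ 2) ^ (ν - 2) • h z := by
  rw [iotaW, integral_withDensity_eq_integral_toReal_smul (by fun_prop)
    (Filter.Eventually.of_forall fun _ => ENNReal.ofReal_lt_top),
    integral_congr_ae (toReal_weight_ae hν h), integral_smul]

theorem integrable_iotaW_iff {ν : ℕ} (hν : 2 ≤ ν) {h : ℂ → ℂ} :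
    Integrable h (iotaW ν) ↔
      IntegrableOn (fun z => (1 - ‖z‖ ^ 2) ^ (ν - 2) • h z) (ball (0 : ℂ) 1) := by
  have h2 : (2 : ℝ) ≤ ν := by exact_mod_cast hν
  have h1 : 0 < (ν : ℝ) - 1 := by linarith
  have hne : ((ν : ℝ) - 1) / Real.pi ≠ 0 := by positivity
  rw [iotaW, integrable_withDensity_iff_integrable_smul' (by fun_prop)
    (Filter.Eventually.of_forall fun _ => ENNReal.ofReal_lt_top),
    integrable_congr (toReal_weight_ae hν h), integrable_fun_smul_iff hne]
  rfl

theorem iotaW_ac (ν : ℕ) : iotaW ν ≪ volume.restrict (ball (0 : ℂ) 1) :=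
  withDensity_absolutelyContinuous _ _

theorem ac_iotaW {ν : ℕ} (hν : 2 ≤ ν) : volume.restrict (ball (0 : ℂ) 1) ≪ iotaW ν := by
  refine withDensity_absolutelyContinuous' (by fun_prop) ?_
  filter_upwards [ae_restrict_mem measurableSet_ball] with z hz
  rw [weight_eq hν hz]
  exact (ENNReal.ofReal_pos.2 (weight_pos hν hz)).ne'

theorem iota_ac : iota ≪ volume.restrict (ball (0 : ℂ) 1) :=
  withDensity_absolutelyContinuous _ _

/-! ### The reproducing property -/

namespace SU11

theorem integrableOn_comp_moebius_iff (g : SU11) {h : ℂ → ℂ} :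
    IntegrableOn h (ball 0 1) ↔ IntegrableOn (fun u : ℂ => (‖((g.b * u + g.a) ^ 2)⁻¹‖ ^ 2) •
      h ((conj g.a * u + conj g.b) / (g.b * u + g.a))) (ball 0 1) := by
  have key := integrableOn_image_iff_integrableOn_abs_det_fderiv_smul volume
    (s := ball (0 : ℂ) 1) measurableSet_ball
    (fun u hu => ((g.hasDerivAt_moebius (mem_ball_zero_iff.1 hu).le).hasFDerivAt.restrictScalars
      ℝ).hasFDerivWithinAt) g.injOn_moebius h
  simpa only [abs_det_restrictScalars_toSpanSingleton, g.image_moebius_ball] using key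

theorem setIntegral_comp_moebius (g : SU11) (h : ℂ → ℂ) :
    ∫ z in ball (0 : ℂ) 1, h z = ∫ u in ball (0 : ℂ) 1, (‖((g.b * u + g.a) ^ 2)⁻¹‖ ^ 2) •
      h ((conj g.a * u + conj g.b) / (g.b * u + g.a)) := by
  have key := integral_image_eq_integral_abs_det_fderiv_smul volume
    (s := ball (0 : ℂ) 1) measurableSet_ball
    (fun u hu => ((g.hasDerivAt_moebius (mem_ball_zero_iff.1 hu).le).hasFDerivAt.restrictScalars
      ℝ).hasFDerivWithinAt) g.injOn_moebius h
  simpa only [abs_det_restrictScalars_toSpanSingleton, g.image_moebius_ball] using key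

theorem one_sub_norm_sq_moebius (g : SU11) {u : ℂ} (hu : ‖u‖ ≤ 1) :
    1 - ‖(conj g.a * u + conj g.b) / (g.b * u + g.a)‖ ^ 2
      = (1 - ‖u‖ ^ 2) * (‖g.b * u + g.a‖ ^ 2)⁻¹ := by
  have hdn := norm_ne_zero_iff.2 (g.den_ne_zero' hu)
  have key : ‖g.b * u + g.a‖ ^ 2 - ‖conj g.a * u + conj g.b‖ ^ 2 = 1 - ‖u‖ ^ 2 := by
    have hr := g.rel
    have : ((‖g.b * u + g.a‖ ^ 2 - ‖conj g.a * u + conj g.b‖ ^ 2 : ℝ) : ℂ)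
        = ((1 - ‖u‖ ^ 2 : ℝ) : ℂ) := by
      push_cast
      rw [← mul_conj', ← mul_conj', ← mul_conj']
      simp only [map_add, map_mul, conj_conj]
      linear_combination (1 - u * conj u) * hr
    exact_mod_cast this
  rw [norm_div, ← key, div_pow, eq_mul_inv_iff_mul_eq₀ (pow_ne_zero 2 hdn), sub_mul,
    div_mul_cancel₀ _ (pow_ne_zero 2 hdn), one_mul]

/-- With `y = g • 0`, the weighted kernel integrand pulled back along `g` is a radial weight times a
holomorphic function. -/
theorem pullback_integrand (g : SU11) {ν : ℕ} (hν : 2 ≤ ν) (F : ℂ → ℂ) {u : ℂ} (hu : ‖u‖ ≤ 1) :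
    (‖((g.b * u + g.a) ^ 2)⁻¹‖ ^ 2) •
      ((1 - ‖(conj g.a * u + conj g.b) / (g.b * u + g.a)‖ ^ 2) ^ (ν - 2) •
        (F ((conj g.a * u + conj g.b) / (g.b * u + g.a)) *
          conj (K ν ((conj g.a * u + conj g.b) / (g.b * u + g.a)) (conj g.b / g.a))))
      = (1 - ‖u‖ ^ 2) ^ (ν - 2) • (F ((conj g.a * u + conj g.b) / (g.b * u + g.a)) *
          (g.a ^ ν * ((g.b * u + g.a) ^ ν)⁻¹)) := by
  have hd := g.den_ne_zero' hu
  have hdn := norm_ne_zero_iff.2 hd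
  have ha : g.a ≠ 0 := norm_pos_iff.1 (lt_of_le_of_lt (norm_nonneg _) g.norm_b_lt)
  have hca : conj g.a ≠ 0 := by simpa using ha
  have hK : conj (K ν ((conj g.a * u + conj g.b) / (g.b * u + g.a)) (conj g.b / g.a))
      = (g.a * conj (g.b * u + g.a)) ^ ν := by
    have : 1 - (conj g.a * u + conj g.b) / (g.b * u + g.a) * conj (conj g.b / g.a)
        = (conj g.a * (g.b * u + g.a))⁻¹ := by
      rw [map_div₀, conj_conj, div_mul_div_comm, mul_comm _ (conj g.a),
        one_sub_div (mul_ne_zero hca hd), inv_eq_one_div]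
      congr 1
      linear_combination g.rel
    rw [K, this, inv_pow, inv_inv, map_pow, map_mul, conj_conj]
  rw [g.one_sub_norm_sq_moebius hu, hK]
  generalize F ((conj g.a * u + conj g.b) / (g.b * u + g.a)) = A
  have hcd : conj (g.b * u + g.a) ≠ 0 := (map_ne_zero _).2 hd
  generalize g.b * u + g.a = d at *
  obtain ⟨m, rfl⟩ := Nat.exists_eq_add_of_le hν
  rw [Nat.add_sub_cancel_left]
  simp only [real_smul, norm_inv, norm_pow]
  push_cast
  rw [← mul_conj' d]
  simp only [mul_inv, mul_pow, inv_pow, pow_add]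
  field_simp

end SU11

theorem inner_kvec_eq_integral (ν : ℕ) (y : 𝔻) {u : bergman ν} {F : ℂ → ℂ}
    (hu : (u : Lp ℂ 2 (iotaW ν)) =ᵐ[iotaW ν] F) :
    Integrable (fun x => F x * conj (K ν x y)) (iotaW ν) ∧
      inner ℂ (kvec ν y) u = ∫ x, F x * conj (K ν x y) ∂iotaW ν := by
  have hk : ((kvec ν y : bergman ν) : Lp ℂ 2 (iotaW ν)) =ᵐ[iotaW ν] fun x => K ν x y :=
    MemLp.coeFn_toLp (memLp_of_holo ν (K_differentiableAt ν y))
  have h : (fun x => inner ℂ ((kvec ν y : Lp ℂ 2 (iotaW ν)) x) ((u : Lp ℂ 2 (iotaW ν)) x))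
      =ᵐ[iotaW ν] fun x => F x * conj (K ν x y) := by
    filter_upwards [hu, hk] with x h1 h2
    rw [h1, h2, RCLike.inner_apply]
  refine ⟨(L2.integrable_inner (𝕜 := ℂ) _ _).congr h, ?_⟩
  rw [Submodule.coe_inner, L2.inner_def]
  exact integral_congr_ae h

/-- The reproducing property `⟨F, K_y⟩ = F(y)`: transported to the centre of the disc by a Möbius
transformation, it is the mean value property. -/
theorem inner_kvec {ν : ℕ} (hν : 2 ≤ ν) (y : 𝔻) {u : bergman ν} {F : ℂ → ℂ}
    (hF : DifferentiableOn ℂ F (ball 0 1)) (hu : (u : Lp ℂ 2 (iotaW ν)) =ᵐ[iotaW ν] F) :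
    inner ℂ (kvec ν y) u = F y := by
  obtain ⟨hint, heq⟩ := inner_kvec_eq_integral ν y hu
  obtain ⟨g, hg⟩ := exists_smul_zero y
  have hy : (y : ℂ) = conj g.b / g.a := by
    rw [← hg, SU11.coe_smul]; simp
  have ha : g.a ≠ 0 := norm_pos_iff.1 (lt_of_le_of_lt (norm_nonneg _) g.norm_b_lt)
  rw [integrable_iotaW_iff hν, g.integrableOn_comp_moebius_iff, hy,
    integrableOn_congr_fun (fun u hu => g.pullback_integrand hν F (mem_ball_zero_iff.1 hu).le)
      measurableSet_ball] at hint
  have hG : DifferentiableOn ℂ (fun u => F ((conj g.a * u + conj g.b) / (g.b * u + g.a)) *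
          (g.a ^ ν * ((g.b * u + g.a) ^ ν)⁻¹)) (ball 0 1) := by
    refine DifferentiableOn.fun_mul (hF.comp (fun u hu =>
      (g.hasDerivAt_moebius (mem_ball_zero_iff.1 hu).le).differentiableAt.differentiableWithinAt)
      ?_) (DifferentiableOn.const_mul (DifferentiableOn.fun_inv (by fun_prop) ?_) _)
    · intro u hu
      rw [← g.image_moebius_ball]
      exact ⟨u, hu, rfl⟩
    · intro u hu
      exact pow_ne_zero _ (g.den_ne_zero' (mem_ball_zero_iff.1 hu).le)
  rw [heq, integral_iotaW hν, g.setIntegral_comp_moebius, hy,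
    setIntegral_congr_fun measurableSet_ball
      (fun u hu => g.pullback_integrand hν F (mem_ball_zero_iff.1 hu).le),
    setIntegral_weight_smul hG hint, smul_smul]
  have h2 : (2 : ℝ) ≤ ν := by exact_mod_cast hν
  have h1 : (ν : ℝ) - 1 ≠ 0 := by linarith
  have hc : ((ν : ℝ) - 1) / Real.pi * (Real.pi / (((ν - 2 : ℕ) : ℝ) + 1)) = 1 := by
    have e : ((ν - 2 : ℕ) : ℝ) + 1 = ν - 1 := by rw [Nat.cast_sub hν]; push_cast; ring
    rw [e]
    field_simp
  rw [hc, one_smul]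
  simp [ha]

/-! ### Pointwise bounds and completeness -/

theorem K_self (ν : ℕ) (z : ℂ) : K ν z z = (((1 - ‖z‖ ^ 2) ^ ν)⁻¹ : ℝ) := by
  rw [K, mul_conj']
  push_cast
  rfl

theorem conj_K (ν : ℕ) (x y : ℂ) : conj (K ν x y) = K ν y x := by
  simp [K, mul_comm]

theorem coeFn_ofHolo (ν : ℕ) {F : ℂ → ℂ}
    (hF : ∀ z ∈ closedBall (0 : ℂ) 1, DifferentiableAt ℂ F z) :
    ((ofHolo ν F hF : bergman ν) : Lp ℂ 2 (iotaW ν)) =ᵐ[iotaW ν] F :=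
  MemLp.coeFn_toLp (memLp_of_holo ν hF)

theorem inner_kvec_ofHolo {ν : ℕ} (hν : 2 ≤ ν) (y : 𝔻) {F : ℂ → ℂ}
    (hF : ∀ z ∈ closedBall (0 : ℂ) 1, DifferentiableAt ℂ F z) :
    inner ℂ (kvec ν y) (ofHolo ν F hF) = F y :=
  inner_kvec hν y (fun z hz => (hF z (ball_subset_closedBall hz)).differentiableWithinAt)
    (coeFn_ofHolo ν hF)

theorem norm_kvec_sq {ν : ℕ} (hν : 2 ≤ ν) (y : 𝔻) :
    ‖kvec ν y‖ ^ 2 = ((1 - ‖(y : ℂ)‖ ^ 2) ^ ν)⁻¹ := by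
  have h : inner ℂ (kvec ν y) (kvec ν y) = K ν y y :=
    inner_kvec_ofHolo hν y (K_differentiableAt ν y)
  have h2 := (inner_self_eq_norm_sq_to_K (𝕜 := ℂ) (kvec ν y)).symm.trans (h.trans (K_self ν y))
  rw [← Complex.ofReal_inj, ofReal_pow]
  exact h2

/-- The pointwise bound `|u(z)| (1 - |z|²)^{ν/2} ≤ ‖u‖`, which is the Cauchy-Schwarz inequality for
`u(z) = ⟨u, K_z⟩`. -/
theorem norm_mul_sqrt_weight_le {ν : ℕ} (hν : 2 ≤ ν) (u : bergman ν) :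
    ∀ᵐ z ∂volume.restrict (ball (0 : ℂ) 1),
      ‖(u : Lp ℂ 2 (iotaW ν)) z‖ * Real.sqrt ((1 - ‖z‖ ^ 2) ^ ν) ≤ ‖u‖ := by
  obtain ⟨F, hF, hu⟩ := u.2
  filter_upwards [(ac_iotaW hν).ae_le hu, ae_restrict_mem measurableSet_ball] with z h1 hz
  have h0 := one_sub_norm_sq_pos hz
  have hz1 := mem_ball_zero_iff.1 hz
  have h3 : ‖F z‖ ≤ ‖kvec ν (UnitDisc.mk z hz1)‖ * ‖u‖ := by
    have := norm_inner_le_norm (𝕜 := ℂ) (kvec ν (UnitDisc.mk z hz1)) u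
    rwa [inner_kvec hν _ hF hu] at this
  have h4 : ‖kvec ν (UnitDisc.mk z hz1)‖ * Real.sqrt ((1 - ‖z‖ ^ 2) ^ ν) = 1 := by
    have hp : 0 < (1 - ‖z‖ ^ 2) ^ ν := pow_pos h0 ν
    have e : (‖kvec ν (UnitDisc.mk z hz1)‖ * Real.sqrt ((1 - ‖z‖ ^ 2) ^ ν)) ^ 2 = 1 := by
      rw [mul_pow, norm_kvec_sq hν, Real.sq_sqrt hp.le, UnitDisc.coe_mk, inv_mul_cancel₀ hp.ne']
    exact (pow_eq_one_iff_of_nonneg (by positivity) two_ne_zero).1 e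
  rw [h1]
  calc ‖F z‖ * Real.sqrt ((1 - ‖z‖ ^ 2) ^ ν)
      ≤ ‖kvec ν (UnitDisc.mk z hz1)‖ * ‖u‖ * Real.sqrt ((1 - ‖z‖ ^ 2) ^ ν) := by gcongr
    _ = ‖u‖ := by rw [mul_right_comm, h4, one_mul]

theorem eq_zero_of_inner_kvec {ν : ℕ} (hν : 2 ≤ ν) {u : bergman ν}
    (h : ∀ y, inner ℂ (kvec ν y) u = 0) : u = 0 := by
  obtain ⟨F, hF, hu⟩ := u.2
  apply Subtype.ext
  apply Lp.ext
  refine hu.trans (Filter.EventuallyEq.trans ?_ (Lp.coeFn_zero ℂ 2 (iotaW ν)).symm)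
  refine (iotaW_ac ν).ae_le ?_
  filter_upwards [ae_restrict_mem measurableSet_ball] with z hz
  have := h (UnitDisc.mk z (mem_ball_zero_iff.1 hz))
  rwa [inner_kvec hν _ hF hu] at this

/-- An `L²`-limit `p` of holomorphic functions is holomorphic: by the reproducing property they
converge to `z ↦ ⟨p, K_z⟩`, uniformly where `‖K_z‖` is bounded. -/
theorem isClosed_bergman {ν : ℕ} (hν : 2 ≤ ν) :
    IsClosed (bergman ν : Set (Lp ℂ 2 (iotaW ν))) := by
  apply IsSeqClosed.isClosed
  intro x p hx hp
  choose F hF hxF using hx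
  set G : ℂ → ℂ := fun z => if h : ‖z‖ < 1 then
    inner ℂ ((kvec ν (UnitDisc.mk z h) : bergman ν) : Lp ℂ 2 (iotaW ν)) p else 0 with hG
  have hdist : ∀ n, ∀ y : 𝔻, dist (G y) (F n y) ≤ ‖kvec ν y‖ * dist (x n) p := fun n y => by
    have h1 : inner ℂ ((kvec ν y : bergman ν) : Lp ℂ 2 (iotaW ν)) (x n) = F n y :=
      inner_kvec hν y (u := ⟨x n, F n, hF n, hxF n⟩) (hF n) (hxF n)
    have h2 : G y = inner ℂ ((kvec ν y : bergman ν) : Lp ℂ 2 (iotaW ν)) p := by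
      simp only [hG, dif_pos y.norm_lt_one, UnitDisc.mk_coe]
    rw [← h1, h2, dist_eq_norm, ← inner_sub_right, dist_comm, dist_eq_norm]
    exact norm_inner_le_norm _ _
  have hd : Filter.Tendsto (fun n => dist (x n) p) Filter.atTop (nhds 0) :=
    tendsto_iff_dist_tendsto_zero.1 hp
  have hlu : TendstoLocallyUniformlyOn F G Filter.atTop (ball 0 1) := by
    rw [Metric.tendstoLocallyUniformlyOn_iff]
    intro ε hε z hz
    obtain ⟨r, hzr, hr⟩ := exists_between (mem_ball_zero_iff.1 hz)
    have hr0 : 0 ≤ r := (norm_nonneg z).trans hzr.le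
    have hr2 : 0 < 1 - r ^ 2 := by nlinarith
    set C := Real.sqrt (((1 - r ^ 2) ^ ν)⁻¹) with hC
    have hlim : Filter.Tendsto (fun n => C * dist (x n) p) Filter.atTop (nhds 0) := by
      simpa using hd.const_mul C
    refine ⟨ball 0 r, mem_nhdsWithin_of_mem_nhds
      (isOpen_ball.mem_nhds (mem_ball_zero_iff.2 hzr)), ?_⟩
    filter_upwards [hlim.eventually_lt_const hε] with n hn y hy
    have hyr := mem_ball_zero_iff.1 hy
    have hk : ‖kvec ν (UnitDisc.mk y (hyr.trans hr))‖ ≤ C := by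
      apply Real.le_sqrt_of_sq_le
      rw [norm_kvec_sq hν, UnitDisc.coe_mk]
      gcongr
    exact ((hdist n (UnitDisc.mk y (hyr.trans hr))).trans (by gcongr)).trans_lt hn
  obtain ⟨ns, hns, hae⟩ := (tendstoInMeasure_of_tendsto_Lp hp).exists_seq_tendsto_ae
  refine ⟨G, hlu.differentiableOn (Filter.Eventually.of_forall hF) isOpen_ball, ?_⟩
  filter_upwards [hae, ae_all_iff.2 hxF, (iotaW_ac ν).ae_le (ae_restrict_mem measurableSet_ball)]
    with z h1 h2 hz
  have h3 := (hlu.tendsto_at hz).comp hns.tendsto_atTop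
  refine tendsto_nhds_unique h1 (h3.congr fun n => ?_)
  exact (h2 (ns n)).symm

theorem completeSpace_bergman {ν : ℕ} (hν : 2 ≤ ν) : CompleteSpace (bergman ν) :=
  (isClosed_bergman hν).completeSpace_coe

/-! ### The Toeplitz operator -/

theorem iota_ac_iotaW {ν : ℕ} (hν : 2 ≤ ν) : iota ≪ iotaW ν := iota_ac.trans (ac_iotaW hν)

/-- The integrand `ū v (1 - |z|²)^ν f` of the sesquilinear form of a Toeplitz operator. -/
def formIntegrand (ν : ℕ) (f u v : ℂ → ℂ) (z : ℂ) : ℂ :=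
  conj (u z) * v z * ((1 - ‖z‖ ^ 2) ^ ν : ℝ) * f z

theorem norm_formFactor_le {ν : ℕ} (hν : 2 ≤ ν) (u v : bergman ν) :
    ∀ᵐ z ∂iota, ‖conj ((u : Lp ℂ 2 (iotaW ν)) z) * (v : Lp ℂ 2 (iotaW ν)) z *
      ((1 - ‖z‖ ^ 2) ^ ν : ℝ)‖ ≤ ‖u‖ * ‖v‖ := by
  filter_upwards [iota_ac.ae_le (norm_mul_sqrt_weight_le hν u),
    iota_ac.ae_le (norm_mul_sqrt_weight_le hν v),
    iota_ac.ae_le (ae_restrict_mem measurableSet_ball)] with z h1 h2 hz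
  have hp := (pow_pos (one_sub_norm_sq_pos hz) ν).le
  rw [norm_mul, norm_mul, RCLike.norm_conj, norm_real, Real.norm_of_nonneg hp]
  calc _ = (‖(u : Lp ℂ 2 (iotaW ν)) z‖ * Real.sqrt ((1 - ‖z‖ ^ 2) ^ ν)) *
        (‖(v : Lp ℂ 2 (iotaW ν)) z‖ * Real.sqrt ((1 - ‖z‖ ^ 2) ^ ν)) := by
        rw [mul_mul_mul_comm, Real.mul_self_sqrt hp]
    _ ≤ _ := by gcongr

theorem integrable_formIntegrand {ν : ℕ} (hν : 2 ≤ ν) {f : ℂ → ℂ} (hf : Integrable f iota)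
    (u v : bergman ν) : Integrable
      (formIntegrand ν f (u : Lp ℂ 2 (iotaW ν)) (v : Lp ℂ 2 (iotaW ν))) iota := by
  refine hf.bdd_mul ?_ (norm_formFactor_le hν u v)
  have hu := (Lp.aestronglyMeasurable (u : Lp ℂ 2 (iotaW ν))).mono_ac (iota_ac_iotaW hν)
  have hv := (Lp.aestronglyMeasurable (v : Lp ℂ 2 (iotaW ν))).mono_ac (iota_ac_iotaW hν)
  exact ((continuous_conj.comp_aestronglyMeasurable hu).mul hv).mul
    (Continuous.aestronglyMeasurable (by fun_prop))

theorem norm_integral_formIntegrand_le {ν : ℕ} (hν : 2 ≤ ν) {f : ℂ → ℂ} (hf : Integrable f iota)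
    (u v : bergman ν) :
    ‖∫ z, formIntegrand ν f (u : Lp ℂ 2 (iotaW ν)) (v : Lp ℂ 2 (iotaW ν)) z ∂iota‖
      ≤ (∫ z, ‖f z‖ ∂iota) * ‖u‖ * ‖v‖ := by
  rw [mul_assoc, mul_comm, ← integral_const_mul]
  refine norm_integral_le_of_norm_le (hf.norm.const_mul _) ?_
  filter_upwards [norm_formFactor_le hν u v] with z hz
  rw [formIntegrand, norm_mul]
  gcongr

/-- The bounded sesquilinear form `(u, v) ↦ ∫ ū v (1 - |z|²)^ν f dι` on `H_ν`. -/
def toeplitzForm {ν : ℕ} (hν : 2 ≤ ν) {f : ℂ → ℂ} (hf : Integrable f iota) :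
    bergman ν →L⋆[ℂ] bergman ν →L[ℂ] ℂ :=
  LinearMap.mkContinuous₂
    (LinearMap.mk₂'ₛₗ (starRingEnd ℂ) (RingHom.id ℂ)
      (fun u v => ∫ z, formIntegrand ν f (u : Lp ℂ 2 (iotaW ν)) (v : Lp ℂ 2 (iotaW ν)) z ∂iota)
      (fun u u' v => by
        rw [← integral_add (integrable_formIntegrand hν hf u v)
          (integrable_formIntegrand hν hf u' v)]
        refine integral_congr_ae ?_
        filter_upwards [(iota_ac_iotaW hν).ae_le (Lp.coeFn_add (u : Lp ℂ 2 (iotaW ν)) u')]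
          with z hz
        simp only [formIntegrand, Submodule.coe_add, hz, Pi.add_apply, map_add]
        ring)
      (fun c u v => by
        rw [← integral_smul]
        refine integral_congr_ae ?_
        filter_upwards [(iota_ac_iotaW hν).ae_le (Lp.coeFn_smul c (u : Lp ℂ 2 (iotaW ν)))]
          with z hz
        simp only [formIntegrand, Submodule.coe_smul, hz, Pi.smul_apply, smul_eq_mul, map_mul]
        ring)
      (fun u v v' => by
        rw [← integral_add (integrable_formIntegrand hν hf u v)
          (integrable_formIntegrand hν hf u v')]
        refine integral_congr_ae ?_
        filter_upwards [(iota_ac_iotaW hν).ae_le (Lp.coeFn_add (v : Lp ℂ 2 (iotaW ν)) v')]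
          with z hz
        simp only [formIntegrand, Submodule.coe_add, hz, Pi.add_apply]
        ring)
      (fun c u v => by
        rw [← integral_smul]
        refine integral_congr_ae ?_
        filter_upwards [(iota_ac_iotaW hν).ae_le (Lp.coeFn_smul c (v : Lp ℂ 2 (iotaW ν)))]
          with z hz
        simp only [formIntegrand, Submodule.coe_smul, hz, Pi.smul_apply, smul_eq_mul,
          RingHom.id_apply]
        ring))
    (∫ z, ‖f z‖ ∂iota) (norm_integral_formIntegrand_le hν hf)

/-- The Riesz representation theorem applied to `toeplitzForm`. -/
theorem exists_inner_eq_integral {ν : ℕ} (hν : 2 ≤ ν) {f : ℂ → ℂ} (hf : Integrable f iota) :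
    ∃ T : bergman ν →L[ℂ] bergman ν, ∀ u v : bergman ν, inner ℂ u (T v)
      = ∫ z, formIntegrand ν f (u : Lp ℂ 2 (iotaW ν)) (v : Lp ℂ 2 (iotaW ν)) z ∂iota := by
  have := completeSpace_bergman hν
  refine ⟨ContinuousLinearMap.adjoint
    (InnerProductSpace.continuousLinearMapOfBilin (toeplitzForm hν hf)), fun u v => ?_⟩
  rw [ContinuousLinearMap.adjoint_inner_right, InnerProductSpace.continuousLinearMapOfBilin_apply]
  rfl

theorem formIntegrand_ofHolo {ν : ℕ} (hν : 2 ≤ ν) (f : ℂ → ℂ) {U V : ℂ → ℂ}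
    (hU : ∀ z ∈ closedBall (0 : ℂ) 1, DifferentiableAt ℂ U z)
    (hV : ∀ z ∈ closedBall (0 : ℂ) 1, DifferentiableAt ℂ V z) :
    formIntegrand ν f (ofHolo ν U hU : Lp ℂ 2 (iotaW ν)) (ofHolo ν V hV : Lp ℂ 2 (iotaW ν))
      =ᵐ[iota] formIntegrand ν f U V := by
  filter_upwards [(iota_ac_iotaW hν).ae_le (coeFn_ofHolo ν hU),
    (iota_ac_iotaW hν).ae_le (coeFn_ofHolo ν hV)] with z h1 h2
  rw [formIntegrand, h1, h2, formIntegrand]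

theorem integral_formIntegrand_K (ν : ℕ) (f : ℂ → ℂ) (x y : 𝔻) :
    ∫ z, formIntegrand ν f (fun z => K ν z x) (fun z => K ν z y) z ∂iota
      = toeplitzKernel ν f x y := by
  refine integral_congr_ae (Filter.Eventually.of_forall fun z => ?_)
  simp only [formIntegrand, conj_K, K_self]
  push_cast
  rw [div_inv_eq_mul]
  ring

/-- A bounded operator on `H_ν` is determined by its kernel, as the vectors `K_y` are total. -/
theorem isToeplitz_unique {ν : ℕ} (hν : 2 ≤ ν) {f : ℂ → ℂ} {S T : bergman ν →L[ℂ] bergman ν}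
    (hS : IsToeplitz ν f S) (hT : IsToeplitz ν f T) : S = T := by
  have := completeSpace_bergman hν
  have h1 : ∀ y, S (kvec ν y) = T (kvec ν y) := fun y => by
    rw [← sub_eq_zero]
    refine eq_zero_of_inner_kvec hν fun x => ?_
    rw [inner_sub_right, sub_eq_zero]
    exact (hS x y).trans (hT x y).symm
  have h2 : ContinuousLinearMap.adjoint S = ContinuousLinearMap.adjoint T := by
    ext1 v
    rw [← sub_eq_zero]
    refine eq_zero_of_inner_kvec hν fun y => ?_
    rw [inner_sub_right, ContinuousLinearMap.adjoint_inner_right,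
      ContinuousLinearMap.adjoint_inner_right, h1, sub_self]
  exact ContinuousLinearMap.adjoint.injective h2

theorem isToeplitz_of_inner_eq_integral {ν : ℕ} (hν : 2 ≤ ν) {f : ℂ → ℂ}
    {T : bergman ν →L[ℂ] bergman ν} (hT : ∀ u v : bergman ν, inner ℂ u (T v)
      = ∫ z, formIntegrand ν f (u : Lp ℂ 2 (iotaW ν)) (v : Lp ℂ 2 (iotaW ν)) z ∂iota) :
    IsToeplitz ν f T := fun x y => by
  rw [opKernel, hT, ← integral_formIntegrand_K]
  exact integral_congr_ae
    (formIntegrand_ofHolo hν f (K_differentiableAt ν x) (K_differentiableAt ν y))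

theorem existsUnique_isToeplitz {ν : ℕ} (hν : 2 ≤ ν) {f : ℂ → ℂ} (hf : Integrable f iota) :
    ∃! T : bergman ν →L[ℂ] bergman ν, IsToeplitz ν f T := by
  obtain ⟨T, hT⟩ := exists_inner_eq_integral hν hf
  exact ⟨T, isToeplitz_of_inner_eq_integral hν hT,
    fun S hS => isToeplitz_unique hν hS (isToeplitz_of_inner_eq_integral hν hT)⟩

theorem isToeplitz_toeplitz {ν : ℕ} (hν : 2 ≤ ν) {f : ℂ → ℂ} (hf : Integrable f iota) :
    IsToeplitz ν f (toeplitz ν f) := by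
  have h := (existsUnique_isToeplitz hν hf).exists
  rw [toeplitz, dif_pos h]
  exact h.choose_spec

theorem inner_toeplitz_ofHolo {ν : ℕ} (hν : 2 ≤ ν) {f : ℂ → ℂ} (hf : Integrable f iota)
    {U V : ℂ → ℂ} (hU : ∀ z ∈ closedBall (0 : ℂ) 1, DifferentiableAt ℂ U z)
    (hV : ∀ z ∈ closedBall (0 : ℂ) 1, DifferentiableAt ℂ V z) :
    inner ℂ (ofHolo ν U hU) (toeplitz ν f (ofHolo ν V hV))
      = ∫ z, formIntegrand ν f U V z ∂iota := by
  obtain ⟨T, hT⟩ := exists_inner_eq_integral hν hf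
  rw [isToeplitz_unique hν (isToeplitz_toeplitz hν hf) (isToeplitz_of_inner_eq_integral hν hT), hT]
  exact integral_congr_ae (formIntegrand_ofHolo hν f hU hV)

/-! ### The Berezin transform and the Husimi function as integrals -/

/-- The function `t(z, w) = (1 - |z|²)(1 - |w|²) / |1 - w z̄|²`, which equals `1 - |g⁻¹ • w|²` for
`z = g • 0`. It is real but taken with complex values, to be multiplied with values of `f`. -/
def berezinFactor (z w : ℂ) : ℂ :=
  (1 - ‖z‖ ^ 2) * (1 - ‖w‖ ^ 2) / ((1 - w * conj z) * conj (1 - w * conj z))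

theorem formIntegrand_K_self_mul (ν : ℕ) (f : ℂ → ℂ) (z w : ℂ) :
    formIntegrand ν f (fun w => K ν w z) (fun w => K ν w z) w * (1 - (‖z‖ : ℂ) ^ 2) ^ ν
      = berezinFactor z w ^ ν * f w := by
  simp only [formIntegrand, K, berezinFactor, div_pow, mul_pow, map_inv₀, map_pow]
  push_cast
  rw [div_eq_mul_inv, mul_inv]
  ring

theorem berezin_eq_integral {ν : ℕ} (hν : 2 ≤ ν) {f : ℂ → ℂ} (hf : Integrable f iota) (z : 𝔻) :
    Integrable (fun w => berezinFactor z w ^ ν * f w) iota ∧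
      berezin ν f z = ∫ w, berezinFactor z w ^ ν * f w ∂iota := by
  simp only [← formIntegrand_K_self_mul]
  refine ⟨Integrable.mul_const ?_ _, ?_⟩
  · exact (integrable_formIntegrand hν hf (kvec ν z) (kvec ν z)).congr
      (formIntegrand_ofHolo hν f (K_differentiableAt ν z) (K_differentiableAt ν z))
  · rw [berezin, covSymbol, isToeplitz_toeplitz hν hf, ← integral_formIntegrand_K,
      integral_mul_const]

theorem E_eq_integral {μ : ℕ} (hμ : 2 ≤ μ) (k : ℕ) {f : ℂ → ℂ} (hf : Integrable f iota) (z : 𝔻) :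
    E μ k f z = (ascPochhammer ℂ k).eval (μ : ℂ) / (k.factorial : ℂ) *
      ∫ w, berezinFactor z w ^ μ * (1 - berezinFactor z w) ^ k * f w ∂iota := by
  have hb := fun j => berezin_eq_integral (Nat.le_add_right_of_le (k := j) hμ) hf z
  rw [E]
  congr 1
  simp only [fun j => (hb j).2, ← integral_const_mul]
  rw [← integral_finsetSum _ fun j _ => (hb j).1.const_mul _]
  refine integral_congr_ae (Filter.Eventually.of_forall fun w => ?_)
  have hbin : (1 - berezinFactor z w) ^ k
      = ∑ j ∈ Finset.range (k + 1), (-1) ^ j * (k.choose j : ℂ) * berezinFactor z w ^ j := by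
    rw [sub_eq_neg_add, add_pow]
    refine Finset.sum_congr rfl fun j _ => ?_
    rw [neg_pow, one_pow]
    ring
  simp only [hbin, Finset.mul_sum, Finset.sum_mul]
  refine Finset.sum_congr rfl fun j _ => ?_
  ring

/-- The pointwise identity `|(g • w^k)(w)|² (1 - |w|²)^μ = t^μ (1 - t)^k` for `z = g • 0`. -/
theorem formIntegrand_act {g : SU11} {z : ℂ} (hz : z = conj g.b / g.a) (μ k : ℕ) (f : ℂ → ℂ)
    {w : ℂ} (hw : ‖w‖ ≤ 1) :
    formIntegrand μ f (act μ g (fun w => w ^ k)) (act μ g (fun w => w ^ k)) w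
      = berezinFactor z w ^ μ * (1 - berezinFactor z w) ^ k * f w := by
  have ha : g.a ≠ 0 := norm_pos_iff.1 (lt_of_le_of_lt (norm_nonneg _) g.norm_b_lt)
  have hca : conj g.a ≠ 0 := (map_ne_zero _).2 ha
  have hd := g.den_ne_zero hw
  have hcd : conj (-g.b * w + conj g.a) ≠ 0 := (map_ne_zero _).2 hd
  have ht : berezinFactor z w
      = (1 - w * conj w) / ((-g.b * w + conj g.a) * conj (-g.b * w + conj g.a)) := by
    have e1 : 1 - w * conj z = (-g.b * w + conj g.a) / conj g.a := by
      rw [hz, map_div₀, conj_conj]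
      field_simp
      ring
    have e2 : 1 - z * conj z = 1 / (g.a * conj g.a) := by
      rw [hz, map_div₀, conj_conj]
      field_simp
      linear_combination g.rel
    rw [berezinFactor, ← mul_conj', ← mul_conj', e1, e2, map_div₀, conj_conj]
    field_simp
  have ht1 : 1 - berezinFactor z w = (g.a * w - conj g.b) * conj (g.a * w - conj g.b) /
      ((-g.b * w + conj g.a) * conj (-g.b * w + conj g.a)) := by
    rw [ht, one_sub_div (mul_ne_zero hd hcd)]
    congr 1
    simp only [map_add, map_sub, map_mul, map_neg, conj_conj]
    linear_combination (1 - w * conj w) * g.rel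
  rw [ht1, ht]
  simp only [formIntegrand, act]
  push_cast
  rw [← mul_conj']
  simp only [map_mul, map_inv₀, map_pow, map_div₀ (starRingEnd ℂ)]
  generalize conj (-g.b * w + conj g.a) = cd at *
  generalize -g.b * w + conj g.a = d at *
  simp only [mul_pow, div_eq_mul_inv, mul_inv]
  ring

theorem husimi_toeplitz_eq_integral {μ : ℕ} (hμ : 2 ≤ μ) (k : ℕ) {f : ℂ → ℂ}
    (hf : Integrable f iota) (z : 𝔻) :
    husimi μ k (toeplitz μ f) z = (ascPochhammer ℂ k).eval (μ : ℂ) / (k.factorial : ℂ) *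
      ∫ w, berezinFactor z w ^ μ * (1 - berezinFactor z w) ^ k * f w ∂iota := by
  obtain ⟨g, rfl⟩ := exists_smul_zero z
  have hz : ((g • (0 : 𝔻) : 𝔻) : ℂ) = conj g.b / g.a := by rw [SU11.coe_smul]; simp
  rw [husimi_smul_zero, actMonomial, inner_toeplitz_ofHolo hμ hf]
  congr 1
  refine integral_congr_ae ?_
  filter_upwards [iota_ac.ae_le (ae_restrict_mem measurableSet_ball)] with w hw
  exact formIntegrand_act hz μ k f (mem_ball_zero_iff.1 hw).le

end BergmanHusimi

end

open BergmanHusimi in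
theorem mainTheorem9 (μ k : ℕ) (hμ : 2 ≤ μ) (f : ℂ → ℂ) (hf : MeasureTheory.Integrable f iota) :
    (∀ ν : ℕ, 2 ≤ ν → ∃! T : bergman ν →L[ℂ] bergman ν, IsToeplitz ν f T) ∧
      ∀ z : Complex.UnitDisc, E μ k f z = husimi μ k (toeplitz μ f) z := by
  refine ⟨fun _ hν => existsUnique_isToeplitz hν hf, fun z => ?_⟩
  rw [E_eq_integral hμ k hf, husimi_toeplitz_eq_integral hμ k hf]
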